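/- Let $L>0$, $0<v<1$, $T>0$ and $\mathbf I_t=(vt,L+vt)$. Let $\phi^0\in H^1_0(0,L)$ and $\phi^1\in L^2(0,L)$ be real-valued, and let $\phi$ be a real-valued weak solution of $$\phi_{tt}-\phi_{xx}=0\ \ (x\in\mathbf I_t,\ 0<t<T),\qquad \phi(vt,t)=\phi(L+vt,t)=0,\qquad \phi(\cdot,0)=\phi^0,\quad \phi_t(\cdot,0)=\phi^1\ \text{ on }(0,L),$$ in the class $\phi\in C([0,T];H^1_0(\mathbf I_t))$, $\phi_t\in C([0,T];L^2(\mathbf I_t))$: the wave equation holds in the sense of distributions on $\{(x,t):0<t<T,\ x\in\mathbf I_t\}$, the boundary condition is the membership $\phi(\cdot,t)\in H_0^1(\mathbf I_t)$, and continuity in time is that of $t\mapsto u(\cdot+vt,t)$, for $u=\phi,\phi_x,\phi_t$, as a map $[0,T]\to L^2(0,L)$. Put $\gamma_v=\frac{1+v}{1-v}$ and $L_2=\frac{2L}{1-v}$, let $\tilde\phi^0_x=\phi^0_x$ and $\tilde\phi^1=\phi^1$ on $(0,L)$ and, for $x\in(L,L_2)$, $$\tilde\phi^0_x(x)=\frac1{\gamma_v}\,\phi^0_x\Big(-\frac{x}{\gamma_v}+\frac{2L}{1+v}\Big),\qquad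 \tilde\phi^1(x)=-\frac1{\gamma_v}\,\phi^1\Big(-\frac{x}{\gamma_v}+\frac{2L}{1+v}\Big),$$ and let $$c_n=\frac1{4n\pi i}\int_0^{L_2}\big(\tilde\phi^0_x+\tilde\phi^1\big)e^{-n\pi i(1-v)x/L}\,dx,\qquad n\in\mathbb Z\setminus\{0\}.$$ Then $\sum_{n\neq0}|nc_n|^2<\infty$, and for every $t\in[0,T]$ the energy $$\mathcal E_v(t)=\frac12\int_{vt}^{L+vt}\Big[(\phi_t+v\phi_x)^2+(1-v^2)\phi_x^2\Big]dx$$ is well defined (its integrand is integrable), does not depend on $t$, that is $\mathcal E_v(t)=\mathcal E_v(0)$, and equals $$\mathcal E_v(t)=\frac{2\pi^2(1-v^2)}{L}\sum_{n\neq0}|nc_n|^2 .$$ Since $T>0$ is arbitrary, for a solution defined for all times this holds for all $t\ge0$. -/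

import Mathlib

open MeasureTheory Set Filter Topology
open scoped ENNReal ContDiff

namespace MovingString

/-- The `L²(a, b)` distance of two real functions. -/
noncomputable def l2Dist (a b : ℝ) (f g : ℝ → ℝ) : ℝ≥0∞ :=
  eLpNorm (fun x => f x - g x) 2 (volume.restrict (Ioo a b))

/-- `f ∈ L²(a, b)`. -/
def MemL2 (a b : ℝ) (f : ℝ → ℝ) : Prop :=
  MemLp f 2 (volume.restrict (Ioo a b))

/-- `η ∈ C_c^∞(a, b)`. -/
structure IsTest (a b : ℝ) (η : ℝ → ℝ) : Prop where
  smooth : ContDiff ℝ ∞ η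
  compact : HasCompactSupport η
  supp : tsupport η ⊆ Ioo a b

/-- `f ∈ H¹₀(a, b)` with weak derivative `g`: the pair `(f, g)` belongs to `L² × L²` and is the
limit in `L² × L²` of pairs `(η, η')` with `η ∈ C_c^∞(a, b)`, that is, `f` lies in the closure of
`C_c^∞(a, b)` for the `H¹` norm. -/
structure MemH10 (a b : ℝ) (f g : ℝ → ℝ) : Prop where
  memL2 : MemL2 a b f
  memL2_deriv : MemL2 a b g
  approx : ∃ η : ℕ → ℝ → ℝ, (∀ k, IsTest a b (η k)) ∧
    Tendsto (fun k => l2Dist a b (η k) f) atTop (𝓝 0) ∧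
    Tendsto (fun k => l2Dist a b (deriv (η k)) g) atTop (𝓝 0)

/-- The space-time domain `{(x, t) : 0 < t < T, vt < x < L + vt}`. -/
def domain (L v T : ℝ) : Set (ℝ × ℝ) :=
  {p | 0 < p.2 ∧ p.2 < T ∧ v * p.2 < p.1 ∧ p.1 < L + v * p.2}

/-- `η ∈ C_c^∞` of the space-time domain; the arguments are `(x, t)`. -/
structure IsSpaceTimeTest (L v T : ℝ) (η : ℝ × ℝ → ℝ) : Prop where
  smooth : ContDiff ℝ ∞ η
  compact : HasCompactSupport η
  supp : tsupport η ⊆ domain L v T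

/-- The partial derivative in `x`. -/
noncomputable def dx (η : ℝ × ℝ → ℝ) (x t : ℝ) : ℝ := deriv (fun y => η (y, t)) x

/-- The partial derivative in `t`. -/
noncomputable def dt (η : ℝ × ℝ → ℝ) (x t : ℝ) : ℝ := deriv (fun s => η (x, s)) t

/-- `∫₀ᵀ ∫_{vt}^{L+vt} F(x, t) dx dt`. -/
noncomputable def spaceTimeIntegral (L v T : ℝ) (F : ℝ → ℝ → ℝ) : ℝ :=
  ∫ t in (0 : ℝ)..T, ∫ x in (v * t)..(L + v * t), F x t

/-- `u ∈ C([0, T]; L²(vt, L + vt))`: each `u(·, t)` is in `L²(vt, L + vt)`, and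
`t ↦ u(· + vt, t)` is continuous from `[0, T]` to `L²(0, L)`. -/
structure ContinuousInL2 (L v T : ℝ) (u : ℝ → ℝ → ℝ) : Prop where
  memL2 : ∀ t ∈ Icc 0 T, MemL2 (v * t) (L + v * t) (fun x => u x t)
  continuous : ∀ s ∈ Icc 0 T,
    Tendsto (fun t => l2Dist 0 L (fun y => u (y + v * t) t) (fun y => u (y + v * s) s))
      (𝓝[Icc 0 T] s) (𝓝 0)

/-- `φ` (a function of `x` and `t`) is the solution on `0 ≤ t ≤ T` of
`φ_tt - φ_xx = 0` in `vt < x < L + vt`, `φ(vt, t) = φ(L + vt, t) = 0`,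
`φ(·, 0) = φ0`, `φ_t(·, 0) = φ1`, in the class
`φ ∈ C([0, T]; H¹₀(vt, L + vt))`, `φ_t ∈ C([0, T]; L²(vt, L + vt))`;
`φx` and `φt` are its weak partial derivatives.
The boundary condition is carried by `H¹₀`. -/
structure IsSolution (L v T : ℝ) (φ0 φ1 : ℝ → ℝ) (φ φx φt : ℝ → ℝ → ℝ) : Prop where
  memH10 : ∀ t ∈ Icc 0 T, MemH10 (v * t) (L + v * t) (fun x => φ x t) (fun x => φx x t)
  continuous : ContinuousInL2 L v T φ
  continuous_x : ContinuousInL2 L v T φx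
  continuous_t : ContinuousInL2 L v T φt
  weak_dt : ∀ η, IsSpaceTimeTest L v T η →
    spaceTimeIntegral L v T (fun x t => φ x t * dt η x t)
      = - spaceTimeIntegral L v T (fun x t => φt x t * η (x, t))
  wave : ∀ η, IsSpaceTimeTest L v T η →
    spaceTimeIntegral L v T (fun x t => φt x t * dt η x t - φx x t * dx η x t) = 0
  init : ∀ᵐ x ∂(volume.restrict (Ioo 0 L)), φ x 0 = φ0 x
  init_t : ∀ᵐ x ∂(volume.restrict (Ioo 0 L)), φt x 0 = φ1 x

/-- The integrand `(φ_t + v φ_x)² + (1 - v²) φ_x²` of the energy at time `t`. -/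
def energyDensity (v : ℝ) (φx φt : ℝ → ℝ → ℝ) (t x : ℝ) : ℝ :=
  (φt x t + v * φx x t) ^ 2 + (1 - v ^ 2) * φx x t ^ 2

/-- The energy at time `t`. -/
noncomputable def energy (L v : ℝ) (φx φt : ℝ → ℝ → ℝ) (t : ℝ) : ℝ :=
  1 / 2 * ∫ x in (v * t)..(L + v * t), energyDensity v φx φt t x

/-- `γ_v = (1 + v) / (1 - v)`. -/
noncomputable def gam (v : ℝ) : ℝ := (1 + v) / (1 - v)

/-- `L₂ = 2L / (1 - v)`. -/
noncomputable def L2 (L v : ℝ) : ℝ := 2 / (1 - v) * L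

/-- Extension of the derivative `g` of the initial shape from `(0, L)` to `(-L₁, L₂)`, where
`L₁ = L / γ_v`. -/
noncomputable def extX (L v : ℝ) (g : ℝ → ℝ) (x : ℝ) : ℝ :=
  if x < 0 then gam v * g (-(gam v * x))
  else if x < L then g x
  else 1 / gam v * g (-x / gam v + 2 * L / (1 + v))

/-- Extension of the initial speed `h` from `(0, L)` to `(-L₁, L₂)`. -/
noncomputable def extT (L v : ℝ) (h : ℝ → ℝ) (x : ℝ) : ℝ :=
  if x < 0 then -(gam v * h (-(gam v * x)))
  else if x < L then h x
  else -(1 / gam v * h (-x / gam v + 2 * L / (1 + v)))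

/-- The coefficients `c_n`, `n ≠ 0`, of the series
`φ(x, t) = ∑ c_n (e^{nπi(1-v)(t+x)/L} - e^{nπi(1+v)(t-x)/L})`, computed from the data:
`φ0x` is the derivative of the initial shape and `φ1` the initial speed. -/
noncomputable def coeff (L v : ℝ) (φ0x φ1 : ℝ → ℝ) (n : ℤ) : ℂ :=
  1 / (4 * n * Real.pi * Complex.I) *
    ∫ x in (0 : ℝ)..(L2 L v), ((extX L v φ0x x + extT L v φ1 x : ℝ) : ℂ) *
      Complex.exp (-(n * Real.pi * Complex.I * (1 - v) * x / L))

end MovingString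

/-! In the moving frame `u(y, t) = φ(y + vt, t)` on the fixed interval `(0, L)`, put `w = u_t = φ_t
+ v φ_x` and `d = u_y`. The wave equation becomes `w_t = ∂_y (2v w + (1 - v²) d)`, together with
`d_t = w_y`. Formally `w` vanishes at the ends, so `⟪w, w_y⟫ = 0` and `⟪w, d_y⟫ = -⟪w_y, d⟫`, and
`‖w‖² + (1 - v²)‖d‖²`, twice the energy, is conserved. Since `w` is only in `L²`, the computation is
done on Steklov averages in time: the average of `w` is a difference quotient of `u`, hence lies in
`H¹₀`, and the step `h` then tends to `0` (`energy_conserved`). Its weak hypotheses come from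
testing with `θ(t) ψ(x - vt)` and the lemma of du Bois-Reymond (`IsSolution.inner_sub_eq`,
`IsSolution.inner_sub_eq_wave`). It remains to compute the energy at time `0`. Its density is half
of `(1 + v)/2 (φ0x + φ1)² + (1 - v)/2 (φ0x - φ1)²`. The extended datum on `(0, L₂)` is `φ0x + φ1`
followed by a reflected, rescaled copy of `φ0x - φ1`, so its square integral has the same two terms
in the same ratio. As `n c_n` is a multiple of its Fourier coefficient and its mean is zero,
Parseval (`hasSum_sq_coeff`) gives the series. -/

namespace MovingString

/-! ### Steklov averages in time. -/

/-- The Steklov average of `f` over `[t, t + h]`. -/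
noncomputable def steklov {H : Type*} [NormedAddCommGroup H] [NormedSpace ℝ H]
    (h : ℝ) (f : ℝ → H) (t : ℝ) : H := h⁻¹ • ∫ τ in t..(t + h), f τ

section Steklov

variable {H : Type*} [NormedAddCommGroup H] [NormedSpace ℝ H] [CompleteSpace H]

theorem hasDerivAt_steklov {f : ℝ → H} (hf : Continuous f) (h t : ℝ) :
    HasDerivAt (steklov h f) (h⁻¹ • (f (t + h) - f t)) t := by
  have hF : ∀ x, HasDerivAt (fun x => ∫ τ in (0 : ℝ)..x, f τ) (f x) x := fun x =>
    intervalIntegral.integral_hasDerivAt_right (hf.intervalIntegrable _ _)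
      hf.aestronglyMeasurable.stronglyMeasurableAtFilter hf.continuousAt
  have h1 : HasDerivAt (fun x => ∫ τ in (0 : ℝ)..(x + h), f τ) (f (t + h)) t :=
    (hF (t + h)).comp_add_const t h
  have h2 := (h1.sub (hF t)).const_smul h⁻¹
  refine h2.congr_of_eventuallyEq (Eventually.of_forall fun x => ?_)
  simp only [steklov, Pi.smul_apply, Pi.sub_apply]
  rw [intervalIntegral.integral_interval_sub_left (hf.intervalIntegrable _ _)
    (hf.intervalIntegrable _ _)]

theorem tendsto_steklov {f : ℝ → H} (hf : Continuous f) (t : ℝ) :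
    Tendsto (fun h => steklov h f t) (𝓝[>] 0) (𝓝 (f t)) := by
  have hF : HasDerivAt (fun x => ∫ τ in t..x, f τ) (f t) t :=
    intervalIntegral.integral_hasDerivAt_right (hf.intervalIntegrable _ _)
      hf.aestronglyMeasurable.stronglyMeasurableAtFilter hf.continuousAt
  have h1 := hF.tendsto_slope_zero_right
  simpa [steklov] using h1

end Steklov

/-! ### Conservation of energy in an abstract Hilbert space. -/

open scoped InnerProductSpace in
/-- Conservation of energy for an abstract second order equation with a skew-symmetric first order
term; `S` is a space of pairs (test function, derivative). -/
theorem energy_conserved {H : Type*} [NormedAddCommGroup H] [InnerProductSpace ℝ H]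
    [CompleteSpace H] (S : Submodule ℝ (H × H))
    (hskew : ∀ P ∈ S, ⟪P.1, P.2⟫_ℝ = 0)
    (hsep : ∀ x : H, (∀ P ∈ S, ⟪x, P.1⟫_ℝ = 0) → x = 0)
    {v T : ℝ} (hT : 0 < T) {u w d : ℝ → H} (hw : Continuous w) (hd : Continuous d)
    (hmem : ∀ t ∈ Icc 0 T, (u t, d t) ∈ S.topologicalClosure)
    (hu' : ∀ P ∈ S, ∀ s ∈ Icc 0 T, ∀ t ∈ Icc 0 T,
      ⟪P.1, u t⟫_ℝ - ⟪P.1, u s⟫_ℝ = ∫ τ in s..t, ⟪P.1, w τ⟫_ℝ)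
    (hw' : ∀ P ∈ S, ∀ s ∈ Icc 0 T, ∀ t ∈ Icc 0 T,
      ⟪P.1, w t⟫_ℝ - ⟪P.1, w s⟫_ℝ
        = -∫ τ in s..t, ⟪P.2, (2 * v) • w τ + (1 - v ^ 2) • d τ⟫_ℝ) :
    ∀ t ∈ Icc 0 T, ‖w t‖ ^ 2 + (1 - v ^ 2) * ‖d t‖ ^ 2 = ‖w 0‖ ^ 2 + (1 - v ^ 2) * ‖d 0‖ ^ 2 := by
  have hclos : ∀ {p : H × H → Prop}, IsClosed {P | p P} → (∀ P ∈ S, p P) →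
      ∀ P ∈ S.topologicalClosure, p P := fun {p} hc hp P hP =>
    closure_minimal (s := (S : Set (H × H))) (t := {P | p P}) hp hc hP
  have hinner : ∀ (x : H) {f : ℝ → H} (_ : Continuous f) (s t : ℝ),
      ∫ τ in s..t, ⟪x, f τ⟫_ℝ = ⟪x, ∫ τ in s..t, f τ⟫_ℝ := fun x f hf s t =>
    (innerSL ℝ x).intervalIntegral_comp_comm (hf.intervalIntegrable _ _)
  have hskew' : ∀ P ∈ S.topologicalClosure, ⟪P.1, P.2⟫_ℝ = 0 :=
    hclos (isClosed_eq (by fun_prop) continuous_const) hskew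
  have hg : Continuous fun τ => (2 * v) • w τ + (1 - v ^ 2) • d τ := by fun_prop
  have hu : ∀ s ∈ Icc 0 T, ∀ t ∈ Icc 0 T, u t - u s = ∫ τ in s..t, w τ := by
    intro s hs t ht
    refine sub_eq_zero.mp (hsep _ fun P hP => ?_)
    rw [real_inner_comm, inner_sub_right, inner_sub_right, hu' P hP s hs t ht, hinner _ hw, sub_self]
  have hweak : ∀ s ∈ Icc 0 T, ∀ t ∈ Icc 0 T, ∀ P ∈ S.topologicalClosure,
      ⟪P.1, w t - w s⟫_ℝ = -⟪P.2, ∫ τ in s..t, ((2 * v) • w τ + (1 - v ^ 2) • d τ)⟫_ℝ := by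
    intro s hs t ht
    refine hclos (isClosed_eq (by fun_prop) (by fun_prop)) fun P hP => ?_
    rw [inner_sub_right, hw' P hP s hs t ht, hinner _ hg]
  -- The averaged energy is differentiable in `t`; the bound `T - h` keeps the window `[t, t + h]`
  -- inside `[0, T]`, where the equations hold.
  have hconst : ∀ h, 0 < h → ∀ t ∈ Icc 0 (T - h),
      ‖steklov h w t‖ ^ 2 + (1 - v ^ 2) * ‖steklov h d t‖ ^ 2
        = ‖steklov h w 0‖ ^ 2 + (1 - v ^ 2) * ‖steklov h d 0‖ ^ 2 := by
    intro h hh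
    have hder : ∀ t, HasDerivAt
        (fun t => ‖steklov h w t‖ ^ 2 + (1 - v ^ 2) * ‖steklov h d t‖ ^ 2)
        (2 * ⟪steklov h w t, h⁻¹ • (w (t + h) - w t)⟫_ℝ
          + (1 - v ^ 2) * (2 * ⟪steklov h d t, h⁻¹ • (d (t + h) - d t)⟫_ℝ)) t := fun t =>
      (hasDerivAt_steklov hw h t).norm_sq.add
        ((hasDerivAt_steklov hd h t).norm_sq.const_mul _)
    refine constant_of_has_deriv_right_zero
      (fun t _ => (hder t).continuousAt.continuousWithinAt) fun t ht => ?_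
    have ht0 : t ∈ Icc 0 T := ⟨ht.1, by linarith [ht.2]⟩
    have ht1 : t + h ∈ Icc 0 T := ⟨by linarith [ht.1], by linarith [ht.2]⟩
    -- This is the gain of regularity: the averaged `w` is a difference quotient of `u`, and its
    -- space derivative is that of `d`, which is also the time derivative of the averaged `d`.
    have hA : steklov h w t = h⁻¹ • (u (t + h) - u t) := by rw [hu t ht0 _ ht1, steklov]
    have hP : (steklov h w t, h⁻¹ • (d (t + h) - d t)) ∈ S.topologicalClosure := by
      rw [hA]
      exact Submodule.smul_mem _ _ (Submodule.sub_mem _ (hmem _ ht1) (hmem _ ht0))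
    have h1 := hskew' _ hP
    have h2 := hweak t ht0 _ ht1 _ hP
    have h3 : h⁻¹ • ∫ τ in t..(t + h), ((2 * v) • w τ + (1 - v ^ 2) • d τ)
        = (2 * v) • steklov h w t + (1 - v ^ 2) • steklov h d t := by
      rw [intervalIntegral.integral_add ((hw.fun_const_smul _).intervalIntegrable _ _)
        ((hd.fun_const_smul _).intervalIntegrable _ _), intervalIntegral.integral_smul,
        intervalIntegral.integral_smul, smul_add, smul_comm _ (2 * v), smul_comm _ (1 - v ^ 2)]
      rfl
    -- The averaged `w` is itself an admissible test element; skew-symmetry (`h1`) removes the `2v`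
    -- term.
    have h4 : ⟪steklov h w t, h⁻¹ • (w (t + h) - w t)⟫_ℝ
        = -((1 - v ^ 2) * ⟪steklov h d t, h⁻¹ • (d (t + h) - d t)⟫_ℝ) := by
      rw [real_inner_smul_right, h2, mul_neg, ← real_inner_smul_right, h3, inner_add_right,
        real_inner_smul_right, real_inner_smul_right, real_inner_comm, h1,
        real_inner_comm (steklov h d t)]
      ring
    refine (hder t).hasDerivWithinAt.congr_deriv ?_
    rw [h4]; ring
  have hlim : ∀ t, Tendsto (fun h => ‖steklov h w t‖ ^ 2 + (1 - v ^ 2) * ‖steklov h d t‖ ^ 2)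
      (𝓝[>] 0) (𝓝 (‖w t‖ ^ 2 + (1 - v ^ 2) * ‖d t‖ ^ 2)) := fun t =>
    ((tendsto_steklov hw t).norm.pow 2).add (((tendsto_steklov hd t).norm.pow 2).const_mul _)
  have hIco : ∀ t ∈ Ico 0 T, ‖w t‖ ^ 2 + (1 - v ^ 2) * ‖d t‖ ^ 2
      = ‖w 0‖ ^ 2 + (1 - v ^ 2) * ‖d 0‖ ^ 2 := by
    intro t ht
    refine tendsto_nhds_unique_of_eventuallyEq (hlim t) (hlim 0) ?_
    filter_upwards [Ioo_mem_nhdsGT (sub_pos.mpr ht.2)] with h hh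
    exact hconst h hh.1 t ⟨ht.1, by linarith [hh.2]⟩
  have hcl : IsClosed {t | ‖w t‖ ^ 2 + (1 - v ^ 2) * ‖d t‖ ^ 2
      = ‖w 0‖ ^ 2 + (1 - v ^ 2) * ‖d 0‖ ^ 2} := isClosed_eq (by fun_prop) continuous_const
  intro t ht
  -- At `t = T` there is no room for a forward average, so the endpoint is reached by continuity.
  rw [← closure_Ico hT.ne] at ht
  exact closure_minimal hIco hcl ht

/-! ### Test functions on an interval and the lemma of du Bois-Reymond. -/

theorem IsTest.eq_zero {a b : ℝ} {η : ℝ → ℝ} (hη : IsTest a b η) {x : ℝ} (hx : x ∉ Ioo a b) :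
    η x = 0 := image_eq_zero_of_notMem_tsupport fun h => hx (hη.supp h)

theorem IsTest.deriv {a b : ℝ} {η : ℝ → ℝ} (hη : IsTest a b η) : IsTest a b (deriv η) where
  smooth := (contDiff_infty_iff_deriv.mp hη.smooth).2
  compact := hη.compact.deriv
  supp := (tsupport_deriv_subset (f := η) (𝕜 := ℝ)).trans hη.supp

theorem IsTest.integral_eq {a b : ℝ} (hab : a ≤ b) {η : ℝ → ℝ} (hη : IsTest a b η) (f : ℝ → ℝ) :
    ∫ x, η x * f x = ∫ x in a..b, η x * f x := by
  rw [intervalIntegral.integral_of_le hab, setIntegral_eq_integral_of_forall_compl_eq_zero]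
  intro x hx
  rw [hη.eq_zero fun h => hx (Ioo_subset_Ioc_self h), zero_mul]

theorem exists_isTest_integral_eq_one {a b : ℝ} (hab : a < b) :
    ∃ ρ, IsTest a b ρ ∧ ∫ x in a..b, ρ x = 1 := by
  let B : ContDiffBump ((a + b) / 2 : ℝ) := ⟨(b - a) / 8, (b - a) / 4, by linarith, by linarith⟩
  have h : IsTest a b (B.normed volume) := by
    refine ⟨B.contDiff_normed, B.hasCompactSupport_normed, ?_⟩
    rw [B.tsupport_normed_eq, Real.closedBall_eq_Icc]
    intro x hx
    have : B.rOut = (b - a) / 4 := rfl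
    rw [this] at hx
    constructor <;> linarith [hx.1, hx.2]
  refine ⟨_, h, ?_⟩
  have h1 := h.integral_eq hab.le fun _ => 1
  simp only [mul_one] at h1
  rw [← h1, B.integral_normed]

/-- A test function with zero integral is the derivative of a test function. -/
theorem IsTest.exists_primitive {a b : ℝ} (hab : a < b) {χ : ℝ → ℝ} (hχ : IsTest a b χ)
    (h0 : ∫ x in a..b, χ x = 0) : ∃ θ, IsTest a b θ ∧ _root_.deriv θ = χ := by
  have hc := hχ.smooth.continuous
  have hder : ∀ x, HasDerivAt (fun x => ∫ τ in a..x, χ τ) (χ x) x := fun x =>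
    intervalIntegral.integral_hasDerivAt_right (hc.intervalIntegrable _ _)
      hc.aestronglyMeasurable.stronglyMeasurableAtFilter hc.continuousAt
  have hderiv : _root_.deriv (fun x => ∫ τ in a..x, χ τ) = χ := funext fun x => (hder x).deriv
  obtain ⟨c, d, hac, hdb, hcd⟩ : ∃ c d, a < c ∧ d < b ∧ tsupport χ ⊆ Icc c d := by
    rcases (tsupport χ).eq_empty_or_nonempty with he | hne
    -- For `χ = 0` the reversed endpoints make `Icc c d` empty.
    · exact ⟨b, a, hab, hab, by simp [he]⟩
    · have hK : IsCompact (tsupport χ) := hχ.compact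
      exact ⟨sInf (tsupport χ), sSup (tsupport χ), (hχ.supp (hK.sInf_mem hne)).1,
        (hχ.supp (hK.sSup_mem hne)).2, hK.isBounded.subset_Icc_sInf_sSup⟩
  have hz : ∀ x, x ∉ Icc c d → χ x = 0 := fun x hx =>
    image_eq_zero_of_notMem_tsupport fun h => hx (hcd h)
  have hsub : Function.support (fun x => ∫ τ in a..x, χ τ) ⊆ Icc c d := by
    intro x hx
    by_contra hxn
    refine hx ?_
    rcases lt_or_ge x c with hxc | hxc
    · refine intervalIntegral.integral_zero_ae (Eventually.of_forall fun τ hτ => hz τ fun h => ?_)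
      have := (mem_uIoc.mp hτ)
      rcases this with h' | h' <;> linarith [h.1, h'.2]
    -- To the right of the support the primitive equals the total integral, which is zero by `h0`.
    · have hxd : d < x := by
        by_contra h
        exact hxn ⟨hxc, not_lt.mp h⟩
      have h1 := intervalIntegral.integral_add_adjacent_intervals (hc.intervalIntegrable a x)
        (hc.intervalIntegrable x b) (μ := volume)
      have h2 : ∫ τ in x..b, χ τ = 0 := by
        refine intervalIntegral.integral_zero_ae (Eventually.of_forall fun τ hτ => hz τ fun h => ?_)
        have := (mem_uIoc.mp hτ)
        rcases this with h' | h' <;> linarith [h.2, h'.1]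
      simp only
      linarith
  have hts : tsupport (fun x => ∫ τ in a..x, χ τ) ⊆ Icc c d := closure_minimal hsub isClosed_Icc
  refine ⟨_, ⟨?_, ?_, ?_⟩, hderiv⟩
  · refine contDiff_infty_iff_deriv.mpr ⟨fun x => (hder x).differentiableAt, ?_⟩
    rw [hderiv]
    exact hχ.smooth
  · exact HasCompactSupport.intro isCompact_Icc fun x hx => by
      by_contra h
      exact hx (hsub h)
  · exact hts.trans fun x hx => ⟨hac.trans_le hx.1, hx.2.trans_lt hdb⟩

theorem IsTest.integral_mul_deriv {a b : ℝ} {θ F g : ℝ → ℝ} (hθ : IsTest a b θ)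
    (hF : ∀ x, HasDerivAt F (g x) x) (hg : Continuous g) :
    ∫ x in a..b, _root_.deriv θ x * F x = -∫ x in a..b, θ x * g x := by
  have hθ' : Continuous (_root_.deriv θ) := hθ.deriv.smooth.continuous
  have h := intervalIntegral.integral_deriv_mul_eq_sub (a := a) (b := b) (u := θ) (v := F)
    (fun x _ => (hθ.smooth.differentiable (by simp) x).hasDerivAt) (fun x _ => hF x)
    (hθ'.intervalIntegrable _ _) (hg.intervalIntegrable _ _)
  have hFc : Continuous F := continuous_iff_continuousAt.mpr fun x => (hF x).continuousAt
  rw [hθ.eq_zero (x := a) (by simp), hθ.eq_zero (x := b) (by simp),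
    intervalIntegral.integral_add ((hθ'.fun_mul hFc).intervalIntegrable _ _)
      ((hθ.smooth.continuous.fun_mul hg).intervalIntegrable _ _)] at h
  linarith

/-- The lemma of du Bois-Reymond. -/
theorem sub_eq_integral_of_weak_deriv {a b : ℝ} (hab : a < b) {f g : ℝ → ℝ} (hf : Continuous f)
    (hg : Continuous g)
    (h : ∀ θ, IsTest a b θ →
      ∫ x in a..b, _root_.deriv θ x * f x = -∫ x in a..b, θ x * g x) :
    ∀ s ∈ Icc a b, ∀ t ∈ Icc a b, f t - f s = ∫ τ in s..t, g τ := by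
  set G : ℝ → ℝ := fun x => ∫ τ in a..x, g τ with hG
  have hGd : ∀ x, HasDerivAt G (g x) x := fun x =>
    intervalIntegral.integral_hasDerivAt_right (hg.intervalIntegrable _ _)
      hg.aestronglyMeasurable.stronglyMeasurableAtFilter hg.continuousAt
  have hGc : Continuous G := continuous_iff_continuousAt.mpr fun x => (hGd x).continuousAt
  have hF : Continuous fun x => f x - G x := hf.sub hGc
  have hzero : ∀ θ, IsTest a b θ → ∫ x in a..b, _root_.deriv θ x * (f x - G x) = 0 := by
    intro θ hθ
    have hθ' : Continuous (_root_.deriv θ) := hθ.deriv.smooth.continuous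
    simp_rw [mul_sub]
    rw [intervalIntegral.integral_sub ((hθ'.fun_mul hf).intervalIntegrable _ _)
      ((hθ'.fun_mul hGc).intervalIntegrable _ _), h θ hθ, hθ.integral_mul_deriv hGd hg, sub_self]
  obtain ⟨ρ, hρ, hρ1⟩ := exists_isTest_integral_eq_one hab
  have hρc := hρ.smooth.continuous
  set c : ℝ := ∫ x in a..b, ρ x * (f x - G x) with hcdef
  have hae : ∀ᵐ x, x ∈ Ioo a b → f x - G x - c = 0 := by
    refine isOpen_Ioo.ae_eq_zero_of_integral_contDiff_smul_eq_zero
      ((hF.sub continuous_const).locallyIntegrable.locallyIntegrableOn _) fun χ h1 h2 h3 => ?_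
    have hχ : IsTest a b χ := ⟨h1, h2, h3⟩
    have hχc := h1.continuous
    set m : ℝ := ∫ x in a..b, χ x with hm
    -- Subtracting `m ρ` makes the integral zero, so the result is some `θ'` and `hzero` applies;
    -- the constant `c` collects the contribution of `ρ`.
    have hκ : IsTest a b fun x => χ x - m * ρ x := by
      refine ⟨h1.sub (contDiff_const.mul hρ.smooth), h2.sub hρ.compact.mul_left, ?_⟩
      refine (tsupport_sub χ fun x => m * ρ x).trans (union_subset h3 ?_)
      exact (tsupport_mul_subset_right (f := fun _ => m) (g := ρ)).trans hρ.supp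
    obtain ⟨θ, hθ, hθd⟩ := hκ.exists_primitive hab (by
      rw [intervalIntegral.integral_sub (hχc.intervalIntegrable _ _)
        ((continuous_const.fun_mul hρc).intervalIntegrable _ _), intervalIntegral.integral_const_mul,
        hρ1, mul_one, sub_self])
    have h4 := hzero θ hθ
    rw [hθd] at h4
    simp_rw [sub_mul _ _ (f _ - G _), mul_assoc m] at h4
    rw [intervalIntegral.integral_sub ((hχc.fun_mul hF).intervalIntegrable _ _)
      ((continuous_const.fun_mul (hρc.fun_mul hF)).intervalIntegrable _ _),
      intervalIntegral.integral_const_mul, ← hcdef] at h4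
    simp only [smul_eq_mul]
    rw [hχ.integral_eq hab.le]
    simp_rw [mul_sub _ _ c]
    rw [intervalIntegral.integral_sub ((hχc.fun_mul hF).intervalIntegrable _ _)
      ((hχc.fun_mul continuous_const).intervalIntegrable _ _), intervalIntegral.integral_mul_const]
    exact h4
  have heq : EqOn (fun x => f x - G x) (fun _ => c) (Icc a b) := by
    refine Measure.eqOn_Icc_of_ae_eq (μ := volume) hab.ne ?_ hF.continuousOn continuousOn_const
    rw [← restrict_Ioo_eq_restrict_Icc]
    filter_upwards [(ae_restrict_iff' measurableSet_Ioo).mpr hae] with x hx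
    exact sub_eq_zero.mp hx
  intro s hs t ht
  have h1 := heq hs
  have h2 := heq ht
  simp only at h1 h2
  have h3 := intervalIntegral.integral_interval_sub_left (hg.intervalIntegrable a t)
    (hg.intervalIntegrable a s) (μ := volume)
  rw [← h3]
  simp only [hG] at h1 h2
  linarith

/-! ### The graph of the derivative on `H¹₀(0, L)` inside `L² × L²`. -/

open scoped InnerProductSpace

/-- The Hilbert space `L²(0, L)`. -/
abbrev Hilb (L : ℝ) : Type := Lp ℝ 2 (volume.restrict (Ioo 0 L))

/-- The class of a square integrable function. -/
noncomputable def MemL2.toLp {L : ℝ} {f : ℝ → ℝ} (h : MemL2 0 L f) : Hilb L := MemLp.toLp f h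

theorem MemL2.coeFn_toLp {L : ℝ} {f : ℝ → ℝ} (h : MemL2 0 L f) :
    h.toLp =ᵐ[volume.restrict (Ioo 0 L)] f := MemLp.coeFn_toLp h

theorem MemL2.edist_toLp {L : ℝ} {f g : ℝ → ℝ} (hf : MemL2 0 L f) (hg : MemL2 0 L g) :
    edist hf.toLp hg.toLp = l2Dist 0 L f g := Lp.edist_toLp_toLp f g hf hg

theorem inner_eq_integral {L : ℝ} (hL : 0 ≤ L) {f g : Hilb L} {F G : ℝ → ℝ}
    (hf : f =ᵐ[volume.restrict (Ioo 0 L)] F) (hg : g =ᵐ[volume.restrict (Ioo 0 L)] G) :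
    ⟪f, g⟫_ℝ = ∫ y in (0 : ℝ)..L, F y * G y := by
  rw [L2.inner_def, intervalIntegral.integral_of_le hL, ← restrict_Ioo_eq_restrict_Ioc]
  refine integral_congr_ae ?_
  filter_upwards [hf, hg] with x h1 h2
  simp [h1, h2, mul_comm]

theorem IsTest.memL2 {a b : ℝ} {η : ℝ → ℝ} (hη : IsTest a b η) (c d : ℝ) : MemL2 c d η :=
  (hη.smooth.continuous.memLp_of_hasCompactSupport hη.compact).restrict _

theorem IsTest.add {a b : ℝ} {η ζ : ℝ → ℝ} (hη : IsTest a b η) (hζ : IsTest a b ζ) :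
    IsTest a b (η + ζ) :=
  ⟨hη.smooth.add hζ.smooth, hη.compact.add hζ.compact,
    (tsupport_add η ζ).trans (union_subset hη.supp hζ.supp)⟩

theorem IsTest.const_smul {a b : ℝ} {η : ℝ → ℝ} (hη : IsTest a b η) (c : ℝ) :
    IsTest a b (c • η) :=
  ⟨hη.smooth.const_smul c, hη.compact.smul_left (f := fun _ => c),
    (tsupport_smul_subset_right (fun _ => c) η).trans hη.supp⟩

theorem IsTest.differentiable {a b : ℝ} {η : ℝ → ℝ} (hη : IsTest a b η) : Differentiable ℝ η :=
  hη.smooth.differentiable (by simp)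

/-- The pairs `(η, η')` with `η ∈ C_c^∞(0, L)`, as a subspace of `L²(0, L) × L²(0, L)`. -/
noncomputable def testSpace (L : ℝ) : Submodule ℝ (Hilb L × Hilb L) where
  carrier := {P | ∃ η, IsTest 0 L η ∧ P.1 =ᵐ[volume.restrict (Ioo 0 L)] η ∧
    P.2 =ᵐ[volume.restrict (Ioo 0 L)] deriv η}
  add_mem' := by
    rintro P Q ⟨η, hη, h1, h2⟩ ⟨ζ, hζ, h3, h4⟩
    refine ⟨η + ζ, hη.add hζ, (Lp.coeFn_add _ _).trans (h1.add h3),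
      (Lp.coeFn_add _ _).trans ((h2.add h4).trans (Eventually.of_forall fun x => ?_))⟩
    exact (deriv_add (hη.differentiable x) (hζ.differentiable x)).symm
  zero_mem' := by
    refine ⟨0, ⟨contDiff_const, HasCompactSupport.zero, by simp [tsupport]⟩, Lp.coeFn_zero _ _ _,
      (Lp.coeFn_zero _ _ _).trans (Eventually.of_forall fun x => ?_)⟩
    simp
  smul_mem' := by
    rintro c P ⟨η, hη, h1, h2⟩
    refine ⟨c • η, hη.const_smul c, (Lp.coeFn_smul _ _).trans (h1.const_smul c),
      (Lp.coeFn_smul _ _).trans ((h2.const_smul c).trans (Eventually.of_forall fun x => ?_))⟩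
    exact (deriv_const_smul c (hη.differentiable x)).symm

/-- The closure of the test pairs: the graph of the derivative on `H¹₀(0, L)`. -/
noncomputable def graphSpace (L : ℝ) : Submodule ℝ (Hilb L × Hilb L) := (testSpace L).topologicalClosure

theorem IsTest.toLp_mem {L : ℝ} {η : ℝ → ℝ} (hη : IsTest 0 L η) :
    ((hη.memL2 0 L).toLp, (hη.deriv.memL2 0 L).toLp) ∈ testSpace L :=
  ⟨η, hη, (hη.memL2 0 L).coeFn_toLp, (hη.deriv.memL2 0 L).coeFn_toLp⟩

/-- Integration by parts, with no boundary term because of the supports. -/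
theorem testSpace_skew {L : ℝ} (hL : 0 ≤ L) {P Q : Hilb L × Hilb L} (hP : P ∈ testSpace L)
    (hQ : Q ∈ testSpace L) : ⟪P.2, Q.1⟫_ℝ = -⟪P.1, Q.2⟫_ℝ := by
  obtain ⟨η, hη, h1, h2⟩ := hP
  obtain ⟨ζ, hζ, h3, h4⟩ := hQ
  rw [inner_eq_integral hL h2 h3, inner_eq_integral hL h1 h4]
  exact hη.integral_mul_deriv (fun x => (hζ.differentiable x).hasDerivAt)
    hζ.deriv.smooth.continuous

theorem graphSpace_induction {L : ℝ} {p : Hilb L × Hilb L → Prop} (hc : IsClosed {P | p P})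
    (hp : ∀ P ∈ testSpace L, p P) : ∀ P ∈ graphSpace L, p P := fun _ hP =>
  closure_minimal (s := (testSpace L : Set (Hilb L × Hilb L))) (t := {P | p P}) hp hc hP

theorem graphSpace_skew {L : ℝ} (hL : 0 ≤ L) {P Q : Hilb L × Hilb L} (hP : P ∈ testSpace L)
    (hQ : Q ∈ graphSpace L) : ⟪P.2, Q.1⟫_ℝ = -⟪P.1, Q.2⟫_ℝ :=
  graphSpace_induction (p := fun Q => ⟪P.2, Q.1⟫_ℝ = -⟪P.1, Q.2⟫_ℝ)
    (isClosed_eq (by fun_prop) (by fun_prop)) (fun _ hQ => testSpace_skew hL hP hQ) Q hQ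

/-- The fundamental lemma of the calculus of variations, as an orthogonality statement. -/
theorem testSpace_separates {L : ℝ} (hL : 0 ≤ L) (x : Hilb L)
    (h : ∀ P ∈ testSpace L, ⟪x, P.1⟫_ℝ = 0) : x = 0 := by
  have hint : IntegrableOn x (Ioo 0 L) := (Lp.memLp x).integrable (by norm_num)
  have hae := isOpen_Ioo.ae_eq_zero_of_integral_contDiff_smul_eq_zero hint.locallyIntegrableOn
    fun η h1 h2 h3 => by
      have hη : IsTest 0 L η := ⟨h1, h2, h3⟩
      have h4 := h _ hη.toLp_mem
      rw [real_inner_comm, inner_eq_integral hL (MemL2.coeFn_toLp _) (ae_eq_refl _),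
        ← hη.integral_eq hL] at h4
      exact h4
  rw [Lp.eq_zero_iff_ae_eq_zero]
  exact (ae_restrict_iff' measurableSet_Ioo).mpr hae

/-- Weak derivatives are unique. -/
theorem graphSpace_snd_unique {L : ℝ} (hL : 0 ≤ L) {f g g' : Hilb L} (h : (f, g) ∈ graphSpace L)
    (h' : (f, g') ∈ graphSpace L) : g = g' := by
  refine sub_eq_zero.mp (testSpace_separates hL _ fun P hP => ?_)
  have h1 := graphSpace_skew hL hP h
  have h2 := graphSpace_skew hL hP h'
  rw [real_inner_comm, inner_sub_right]
  linarith

theorem MemH10.mem_graphSpace {L : ℝ} {f g : ℝ → ℝ} (h : MemH10 0 L f g) :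
    (h.memL2.toLp, h.memL2_deriv.toLp) ∈ graphSpace L := by
  obtain ⟨η, hη, h1, h2⟩ := h.approx
  have h3 : Tendsto (fun k => ((hη k).memL2 0 L).toLp) atTop (𝓝 h.memL2.toLp) := by
    rw [tendsto_iff_edist_tendsto_0]
    simpa only [MemL2.edist_toLp] using h1
  have h4 : Tendsto (fun k => ((hη k).deriv.memL2 0 L).toLp) atTop (𝓝 h.memL2_deriv.toLp) := by
    rw [tendsto_iff_edist_tendsto_0]
    simpa only [MemL2.edist_toLp] using h2
  exact mem_closure_of_tendsto (h3.prodMk_nhds h4) (Eventually.of_forall fun k => (hη k).toLp_mem)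

/-- Pairing with the constant `1`, which is in `L²` of a bounded interval, is continuous and kills
every `η'`. This is what later makes the zeroth Fourier coefficient vanish. -/
theorem MemH10.integral_deriv_eq_zero {L : ℝ} (hL : 0 ≤ L) {f g : ℝ → ℝ} (h : MemH10 0 L f g) :
    ∫ x in (0 : ℝ)..L, g x = 0 := by
  have h1 : MemL2 0 L fun _ => 1 := memLp_const 1
  have h2 := graphSpace_induction (p := fun P => ⟪P.2, h1.toLp⟫_ℝ = 0)
    (isClosed_eq (by fun_prop) continuous_const) (by
      rintro P ⟨η, hη, -, h4⟩
      rw [inner_eq_integral hL h4 (MemL2.coeFn_toLp _),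
        hη.integral_mul_deriv (fun x => hasDerivAt_const x (1 : ℝ)) continuous_const]
      simp) _ h.mem_graphSpace
  simp only at h2
  rw [inner_eq_integral hL (MemL2.coeFn_toLp _) (MemL2.coeFn_toLp _)] at h2
  simpa using h2

/-! ### Passage to the moving frame. -/

theorem measurePreserving_add_Ioo (a b c : ℝ) :
    MeasurePreserving (fun y => y + c) (volume.restrict (Ioo a b))
      (volume.restrict (Ioo (a + c) (b + c))) := by
  have h := (measurePreserving_add_right volume c).restrict_preimage
    (measurableSet_Ioo (a := a + c) (b := b + c))
  simpa using h

theorem MemL2.shift {a b c : ℝ} {f : ℝ → ℝ} (h : MemL2 (a + c) (b + c) f) :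
    MemL2 a b fun y => f (y + c) :=
  MemLp.comp_measurePreserving h (measurePreserving_add_Ioo a b c)

theorem l2Dist_shift {a b c : ℝ} {f g : ℝ → ℝ} (hf : MemL2 (a + c) (b + c) f)
    (hg : MemL2 (a + c) (b + c) g) :
    l2Dist a b (fun y => f (y + c)) (fun y => g (y + c)) = l2Dist (a + c) (b + c) f g :=
  eLpNorm_comp_measurePreserving (g := fun x => f x - g x) (hf.sub hg).aestronglyMeasurable
    (measurePreserving_add_Ioo a b c)

theorem IsTest.shift {a b c : ℝ} {η : ℝ → ℝ} (h : IsTest (a + c) (b + c) η) :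
    IsTest a b fun y => η (y + c) where
  smooth := h.smooth.comp (contDiff_id.add contDiff_const)
  compact := h.compact.comp_homeomorph (Homeomorph.addRight c)
  supp := by
    have h1 := tsupport_comp_eq_preimage η (Homeomorph.addRight c)
    intro x hx
    have h2 := h.supp ((h1 ▸ hx : x ∈ Homeomorph.addRight c ⁻¹' tsupport η))
    simpa using h2

theorem MemH10.shift {a b c : ℝ} {f g : ℝ → ℝ} (h : MemH10 (a + c) (b + c) f g) :
    MemH10 a b (fun y => f (y + c)) (fun y => g (y + c)) := by
  obtain ⟨η, hη, h1, h2⟩ := h.approx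
  refine ⟨h.memL2.shift, h.memL2_deriv.shift, fun k y => η k (y + c), fun k => (hη k).shift, ?_, ?_⟩
  · simp_rw [l2Dist_shift ((hη _).memL2 _ _) h.memL2]
    exact h1
  · have h3 : ∀ k, deriv (fun y => η k (y + c)) = fun y => deriv (η k) (y + c) := fun k =>
      funext fun y => deriv_comp_add_const _ _ _
    simp_rw [h3, l2Dist_shift ((hη _).deriv.memL2 _ _) h.memL2_deriv]
    exact h2

theorem ContinuousInL2.memL2_frame {L v T : ℝ} {u : ℝ → ℝ → ℝ} (h : ContinuousInL2 L v T u)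
    {t : ℝ} (ht : t ∈ Icc 0 T) : MemL2 0 L fun y => u (y + v * t) t := by
  have := h.memL2 t ht
  exact MemL2.shift (f := fun x => u x t) (by rwa [zero_add])

/-- `t ↦ u(· + vt, t)` as a function with values in `L²(0, L)`, extended from `[0, T]` to `ℝ` by
constants. -/
noncomputable def ContinuousInL2.frame {L v T : ℝ} {u : ℝ → ℝ → ℝ} (h : ContinuousInL2 L v T u)
    (hT : 0 ≤ T) : ℝ → Hilb L :=
  IccExtend hT fun s => (h.memL2_frame s.2).toLp

theorem ContinuousInL2.continuous_frame {L v T : ℝ} {u : ℝ → ℝ → ℝ} (h : ContinuousInL2 L v T u)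
    (hT : 0 ≤ T) : Continuous (h.frame hT) := by
  refine Continuous.Icc_extend' (continuous_iff_continuousAt.mpr fun s => ?_)
  rw [ContinuousAt, tendsto_iff_edist_tendsto_0]
  simp_rw [MemL2.edist_toLp]
  exact (h.continuous s s.2).comp (tendsto_nhdsWithin_iff.mpr
    ⟨continuous_subtype_val.continuousAt, Eventually.of_forall fun t => t.2⟩)

theorem ContinuousInL2.frame_eq {L v T : ℝ} {u : ℝ → ℝ → ℝ} (h : ContinuousInL2 L v T u)
    (hT : 0 ≤ T) {t : ℝ} (ht : t ∈ Icc 0 T) :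
    h.frame hT t = (h.memL2_frame ht).toLp := IccExtend_of_mem _ _ ht

theorem ContinuousInL2.coeFn_frame {L v T : ℝ} {u : ℝ → ℝ → ℝ} (h : ContinuousInL2 L v T u)
    (hT : 0 ≤ T) {t : ℝ} (ht : t ∈ Icc 0 T) :
    h.frame hT t =ᵐ[volume.restrict (Ioo 0 L)] fun y => u (y + v * t) t := by
  rw [h.frame_eq hT ht]
  exact MemL2.coeFn_toLp _

theorem integral_moving {L v t : ℝ} (f : ℝ → ℝ) :
    ∫ x in (v * t)..(L + v * t), f x = ∫ y in (0 : ℝ)..L, f (y + v * t) := by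
  rw [intervalIntegral.integral_comp_add_right, zero_add]

/-! ### Product test functions adapted to the moving frame. -/

section Product

variable {L v T : ℝ} {θ ψ : ℝ → ℝ}

theorem isSpaceTimeTest_product (hθ : IsTest 0 T θ) (hψ : IsTest 0 L ψ) :
    IsSpaceTimeTest L v T fun p => θ p.2 * ψ (p.1 - v * p.2) := by
  have hsub : tsupport (fun p : ℝ × ℝ => θ p.2 * ψ (p.1 - v * p.2))
      ⊆ {p | p.2 ∈ tsupport θ ∧ p.1 - v * p.2 ∈ tsupport ψ} := by
    refine closure_minimal (fun p hp => ?_) ?_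
    · have := mul_ne_zero_iff.mp (Function.mem_support.mp hp)
      exact ⟨subset_tsupport _ this.1, subset_tsupport _ this.2⟩
    · exact ((isClosed_tsupport θ).preimage continuous_snd).inter
        ((isClosed_tsupport ψ).preimage (by fun_prop : Continuous fun p : ℝ × ℝ => p.1 - v * p.2))
  refine ⟨?_, ?_, fun p hp => ?_⟩
  · exact (hθ.smooth.comp contDiff_snd).mul
      (hψ.smooth.comp (contDiff_fst.sub (contDiff_const.mul contDiff_snd)))
  -- The map is `(t, y) ↦ (y + vt, t)`, from frame coordinates back to space-time.
  · have hK : IsCompact ((fun q : ℝ × ℝ => (q.2 + v * q.1, q.1)) '' (tsupport θ ×ˢ tsupport ψ)) :=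
      (IsCompact.prod hθ.compact hψ.compact).image (by fun_prop)
    refine hK.of_isClosed_subset (isClosed_tsupport _) fun p hp => ?_
    have h := hsub hp
    exact ⟨(p.2, p.1 - v * p.2), ⟨h.1, h.2⟩, by simp⟩
  · have h := hsub hp
    have h1 := hθ.supp h.1
    have h2 := hψ.supp h.2
    exact ⟨h1.1, h1.2, by linarith [h2.1], by linarith [h2.2]⟩

theorem dx_product (hψ : IsTest 0 L ψ) (x t : ℝ) :
    dx (fun p => θ p.2 * ψ (p.1 - v * p.2)) x t = θ t * deriv ψ (x - v * t) := by
  have h : HasDerivAt (fun y => θ t * ψ (y - v * t)) (θ t * deriv ψ (x - v * t)) x :=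
    (HasDerivAt.comp_sub_const x (v * t) (hψ.differentiable _).hasDerivAt).const_mul _
  exact h.deriv

theorem dt_product (hθ : IsTest 0 T θ) (hψ : IsTest 0 L ψ) (x t : ℝ) :
    dt (fun p => θ p.2 * ψ (p.1 - v * p.2)) x t
      = deriv θ t * ψ (x - v * t) - v * (θ t * deriv ψ (x - v * t)) := by
  have h1 : HasDerivAt (fun s => x - v * s) (-v) t := by
    simpa using ((hasDerivAt_id t).const_mul v).const_sub x
  have h2 : HasDerivAt (fun s => ψ (x - v * s)) (deriv ψ (x - v * t) * -v) t :=
    HasDerivAt.comp t (hψ.differentiable (x - v * t)).hasDerivAt h1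
  have h := (hθ.differentiable t).hasDerivAt.mul h2
  refine h.deriv.trans ?_
  ring

end Product

theorem MemL2.intervalIntegrable_mul {a b : ℝ} (hab : a ≤ b) {f g : ℝ → ℝ} (hf : MemL2 a b f)
    (hg : MemL2 a b g) : IntervalIntegrable (fun x => f x * g x) volume a b := by
  rw [intervalIntegrable_iff_integrableOn_Ioo_of_le hab]
  exact MemLp.integrable_mul hf hg

theorem integral_mul_slice {L : ℝ} (hL : 0 ≤ L) {u ψ₁ ψ₂ : ℝ → ℝ} {f : Hilb L} (hu : MemL2 0 L u)
    (hf : f =ᵐ[volume.restrict (Ioo 0 L)] u) (h₁ : MemL2 0 L ψ₁) (h₂ : MemL2 0 L ψ₂) (a b : ℝ) :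
    ∫ y in (0 : ℝ)..L, u y * (a * ψ₁ y + b * ψ₂ y) = a * ⟪h₁.toLp, f⟫_ℝ + b * ⟪h₂.toLp, f⟫_ℝ := by
  rw [inner_eq_integral hL h₁.coeFn_toLp hf, inner_eq_integral hL h₂.coeFn_toLp hf,
    ← intervalIntegral.integral_const_mul, ← intervalIntegral.integral_const_mul,
    ← intervalIntegral.integral_add ((h₁.intervalIntegrable_mul hL hu).const_mul a)
      ((h₂.intervalIntegrable_mul hL hu).const_mul b)]
  congr 1
  ext y
  ring

theorem spaceTimeIntegral_eq {L v T : ℝ} (hT : 0 ≤ T) {G : ℝ → ℝ → ℝ} {g : ℝ → ℝ}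
    (h : ∀ t ∈ Icc 0 T, ∫ y in (0 : ℝ)..L, G (y + v * t) t = g t) :
    spaceTimeIntegral L v T G = ∫ t in (0 : ℝ)..T, g t := by
  refine intervalIntegral.integral_congr fun t ht => ?_
  rw [uIcc_of_le hT] at ht
  exact (integral_moving fun x => G x t).trans (h t ht)

/-! ### Weak equations and conservation for a solution. -/

section Solution

variable {L v T : ℝ} {φ0 φ1 : ℝ → ℝ} {φ φx φt : ℝ → ℝ → ℝ}

theorem IsSolution.mem_graphSpace (hφ : IsSolution L v T φ0 φ1 φ φx φt) (hT : 0 ≤ T) {t : ℝ}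
    (ht : t ∈ Icc 0 T) :
    (hφ.continuous.frame hT t, hφ.continuous_x.frame hT t) ∈ graphSpace L := by
  have h : MemH10 (0 + v * t) (L + v * t) (fun x => φ x t) fun x => φx x t := by
    simpa using hφ.memH10 t ht
  rw [ContinuousInL2.frame_eq _ _ ht, ContinuousInL2.frame_eq _ _ ht]
  exact h.shift.mem_graphSpace

/-- In the moving frame, `u_t = φ_t + v φ_x` weakly. -/
theorem IsSolution.inner_sub_eq (hφ : IsSolution L v T φ0 φ1 φ φx φt) (hL : 0 ≤ L) (hT : 0 < T)
    {P : Hilb L × Hilb L} (hP : P ∈ testSpace L) :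
    ∀ s ∈ Icc 0 T, ∀ t ∈ Icc 0 T,
      ⟪P.1, hφ.continuous.frame hT.le t⟫_ℝ - ⟪P.1, hφ.continuous.frame hT.le s⟫_ℝ
        = ∫ τ in s..t, ⟪P.1, hφ.continuous_t.frame hT.le τ + v • hφ.continuous_x.frame hT.le τ⟫_ℝ := by
  obtain ⟨ψ, hψ, h1, h2⟩ := hP
  have e1 : P.1 = (hψ.memL2 0 L).toLp := Lp.ext (h1.trans (MemL2.coeFn_toLp _).symm)
  have hcu := hφ.continuous.continuous_frame hT.le
  have hcd := hφ.continuous_x.continuous_frame hT.le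
  have hcf := hφ.continuous_t.continuous_frame hT.le
  rw [e1]
  refine sub_eq_integral_of_weak_deriv hT (by fun_prop) (by fun_prop) fun θ hθ => ?_
  have hw := hφ.weak_dt _ (isSpaceTimeTest_product hθ hψ)
  rw [spaceTimeIntegral_eq hT.le (g := fun t =>
      deriv θ t * ⟪(hψ.memL2 0 L).toLp, hφ.continuous.frame hT.le t⟫_ℝ
        + v * (θ t * ⟪(hψ.memL2 0 L).toLp, hφ.continuous_x.frame hT.le t⟫_ℝ)),
    spaceTimeIntegral_eq hT.le (g := fun t =>
      θ t * ⟪(hψ.memL2 0 L).toLp, hφ.continuous_t.frame hT.le t⟫_ℝ)] at hw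
  · have hθ' : Continuous (deriv θ) := hθ.deriv.smooth.continuous
    have hθc := hθ.smooth.continuous
    rw [intervalIntegral.integral_add (Continuous.intervalIntegrable (by fun_prop) _ _)
      (Continuous.intervalIntegrable (by fun_prop) _ _)] at hw
    simp_rw [inner_add_right, real_inner_smul_right, mul_add, mul_left_comm (θ _) v]
    rw [intervalIntegral.integral_add (Continuous.intervalIntegrable (by fun_prop) _ _)
      (Continuous.intervalIntegrable (by fun_prop) _ _)]
    linarith
  · intro t ht
    rw [inner_eq_integral hL (MemL2.coeFn_toLp _) (hφ.continuous_t.coeFn_frame hT.le ht),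
      ← intervalIntegral.integral_const_mul]
    congr 1
    ext y
    simp only [add_sub_cancel_right]
    ring
  · intro t ht
    have h3 := integral_mul_slice hL (hφ.continuous.memL2_frame ht)
      (hφ.continuous.coeFn_frame hT.le ht) (hψ.memL2 0 L) (hψ.deriv.memL2 0 L) (deriv θ t)
      (-(v * θ t))
    -- The derivative moves from `ψ` onto `φ`: this turns the transport term of `dt_product` into `v
    -- φ_x`.
    have h4 := graphSpace_skew hL hψ.toLp_mem (hφ.mem_graphSpace hT.le ht)
    simp only at h4
    rw [h4] at h3
    simp_rw [dt_product hθ hψ, add_sub_cancel_right]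
    rw [show v * (θ t * ⟪(hψ.memL2 0 L).toLp, hφ.continuous_x.frame hT.le t⟫_ℝ) = -(v * θ t)
      * -⟪(hψ.memL2 0 L).toLp, hφ.continuous_x.frame hT.le t⟫_ℝ by ring, ← h3]
    congr 1
    ext y
    ring

/-- The wave equation tested against a fixed function in the moving frame. -/
theorem IsSolution.inner_sub_eq_wave (hφ : IsSolution L v T φ0 φ1 φ φx φt) (hL : 0 ≤ L)
    (hT : 0 < T) {P : Hilb L × Hilb L} (hP : P ∈ testSpace L) :
    ∀ s ∈ Icc 0 T, ∀ t ∈ Icc 0 T,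
      ⟪P.1, hφ.continuous_t.frame hT.le t⟫_ℝ - ⟪P.1, hφ.continuous_t.frame hT.le s⟫_ℝ
        = ∫ τ in s..t,
          -⟪P.2, v • hφ.continuous_t.frame hT.le τ + hφ.continuous_x.frame hT.le τ⟫_ℝ := by
  obtain ⟨ψ, hψ, h1, h2⟩ := hP
  have e1 : P.1 = (hψ.memL2 0 L).toLp := Lp.ext (h1.trans (MemL2.coeFn_toLp _).symm)
  have e2 : P.2 = (hψ.deriv.memL2 0 L).toLp := Lp.ext (h2.trans (MemL2.coeFn_toLp _).symm)
  have hcd := hφ.continuous_x.continuous_frame hT.le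
  have hcf := hφ.continuous_t.continuous_frame hT.le
  rw [e1, e2]
  refine sub_eq_integral_of_weak_deriv hT (by fun_prop) (by fun_prop) fun θ hθ => ?_
  have hw := hφ.wave _ (isSpaceTimeTest_product hθ hψ)
  rw [spaceTimeIntegral_eq hT.le (g := fun t =>
      deriv θ t * ⟪(hψ.memL2 0 L).toLp, hφ.continuous_t.frame hT.le t⟫_ℝ
        + θ t * -⟪(hψ.deriv.memL2 0 L).toLp,
          v • hφ.continuous_t.frame hT.le t + hφ.continuous_x.frame hT.le t⟫_ℝ)] at hw
  · have hθ' : Continuous (deriv θ) := hθ.deriv.smooth.continuous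
    have hθc := hθ.smooth.continuous
    rw [intervalIntegral.integral_add (Continuous.intervalIntegrable (by fun_prop) _ _)
      (Continuous.intervalIntegrable (by fun_prop) _ _)] at hw
    linarith
  · intro t ht
    have h3 := integral_mul_slice hL (hφ.continuous_t.memL2_frame ht)
      (hφ.continuous_t.coeFn_frame hT.le ht) (hψ.memL2 0 L) (hψ.deriv.memL2 0 L) (deriv θ t)
      (-(v * θ t))
    have h4 := integral_mul_slice hL (hφ.continuous_x.memL2_frame ht)
      (hφ.continuous_x.coeFn_frame hT.le ht) (hψ.memL2 0 L) (hψ.deriv.memL2 0 L) 0 (θ t)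
    have i1 := ((hψ.memL2 0 L).intervalIntegrable_mul hL (hφ.continuous_t.memL2_frame ht))
    have i2 := ((hψ.deriv.memL2 0 L).intervalIntegrable_mul hL (hφ.continuous_t.memL2_frame ht))
    have i3 := ((hψ.deriv.memL2 0 L).intervalIntegrable_mul hL (hφ.continuous_x.memL2_frame ht))
    rw [inner_add_right, real_inner_smul_right]
    trans (∫ y in (0 : ℝ)..L, φt (y + v * t) t * (deriv θ t * ψ y + -(v * θ t) * deriv ψ y))
      - ∫ y in (0 : ℝ)..L, φx (y + v * t) t * (0 * ψ y + θ t * deriv ψ y)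
    · rw [← intervalIntegral.integral_sub]
      · simp_rw [dt_product hθ hψ, dx_product hψ, add_sub_cancel_right]
        congr 1
        ext y
        ring
      · refine ((i1.const_mul (deriv θ t)).add (i2.const_mul (-(v * θ t)))).congr
          (fun y _ => ?_)
        ring
      · refine (i3.const_mul (θ t)).congr (fun y _ => ?_)
        ring
    · rw [h3, h4]
      ring

/-- The equation for `w = φ_t + v φ_x` is the wave identity for `φ_t` plus `v` times the one for
`φ_x`, the latter obtained from `⟪ψ, φ_x⟫ = -⟪ψ', φ⟫`. -/
theorem IsSolution.norm_sq_conserved (hφ : IsSolution L v T φ0 φ1 φ φx φt) (hL : 0 ≤ L)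
    (hT : 0 < T) : ∀ t ∈ Icc 0 T,
      ‖hφ.continuous_t.frame hT.le t + v • hφ.continuous_x.frame hT.le t‖ ^ 2
          + (1 - v ^ 2) * ‖hφ.continuous_x.frame hT.le t‖ ^ 2
        = ‖hφ.continuous_t.frame hT.le 0 + v • hφ.continuous_x.frame hT.le 0‖ ^ 2
          + (1 - v ^ 2) * ‖hφ.continuous_x.frame hT.le 0‖ ^ 2 := by
  have hcd := hφ.continuous_x.continuous_frame hT.le
  have hcf := hφ.continuous_t.continuous_frame hT.le
  refine energy_conserved (testSpace L) (u := hφ.continuous.frame hT.le)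
    (fun P hP => ?_) (testSpace_separates hL) hT (by fun_prop) hcd
    (fun t ht => hφ.mem_graphSpace hT.le ht) (fun P hP => hφ.inner_sub_eq hL hT hP)
    fun P hP s hs t ht => ?_
  · have h := testSpace_skew hL hP hP
    rw [real_inner_comm] at h
    linarith
  -- `ψ'` is again a test function, so the evolution of `⟪ψ', φ⟫` is known.
  · obtain ⟨Q, hQ, hQP⟩ : ∃ Q ∈ testSpace L, Q.1 = P.2 := by
      obtain ⟨ψ, hψ, -, h2⟩ := hP
      exact ⟨_, hψ.deriv.toLp_mem, Lp.ext ((hψ.deriv.memL2 0 L).coeFn_toLp.trans h2.symm)⟩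
    have h1 := hφ.inner_sub_eq hL hT hQ s hs t ht
    have h2 := hφ.inner_sub_eq_wave hL hT hP s hs t ht
    have h3 := graphSpace_skew hL hP (hφ.mem_graphSpace hT.le hs)
    have h4 := graphSpace_skew hL hP (hφ.mem_graphSpace hT.le ht)
    simp only at h3 h4
    rw [hQP, h3, h4] at h1
    have h5 : ∫ τ in s..t, ⟪P.2, (2 * v) • (hφ.continuous_t.frame hT.le τ
          + v • hφ.continuous_x.frame hT.le τ) + (1 - v ^ 2) • hφ.continuous_x.frame hT.le τ⟫_ℝ
        = v * (∫ τ in s..t, ⟪P.2, hφ.continuous_t.frame hT.le τ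
          + v • hφ.continuous_x.frame hT.le τ⟫_ℝ)
        - ∫ τ in s..t,
          -⟪P.2, v • hφ.continuous_t.frame hT.le τ + hφ.continuous_x.frame hT.le τ⟫_ℝ := by
      rw [← intervalIntegral.integral_const_mul, ← intervalIntegral.integral_sub
        (Continuous.intervalIntegrable (by fun_prop) _ _)
        (Continuous.intervalIntegrable (by fun_prop) _ _)]
      congr 1
      ext τ
      simp only [inner_add_right, real_inner_smul_right]
      ring
    rw [h5, ← h1, ← h2, inner_add_right, inner_add_right, real_inner_smul_right,
      real_inner_smul_right]
    ring

theorem IsSolution.intervalIntegrable_energyDensity (hφ : IsSolution L v T φ0 φ1 φ φx φt)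
    (hL : 0 ≤ L) {t : ℝ} (ht : t ∈ Icc 0 T) :
    IntervalIntegrable (energyDensity v φx φt t) volume (v * t) (L + v * t) := by
  have hx := hφ.continuous_x.memL2 t ht
  have ht' := hφ.continuous_t.memL2 t ht
  have hw : MemL2 (v * t) (L + v * t) fun x => φt x t + v * φx x t :=
    MemLp.add ht' (MemLp.const_mul hx v)
  have hab : v * t ≤ L + v * t := by linarith
  refine ((hw.intervalIntegrable_mul hab hw).add
    ((hx.intervalIntegrable_mul hab hx).const_mul (1 - v ^ 2))).congr
    (fun x _ => ?_)
  simp only [energyDensity]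
  ring

theorem IsSolution.energy_eq_norm_sq (hφ : IsSolution L v T φ0 φ1 φ φx φt) (hL : 0 ≤ L)
    (hT : 0 ≤ T) {t : ℝ} (ht : t ∈ Icc 0 T) :
    energy L v φx φt t = 1 / 2 * (‖hφ.continuous_t.frame hT t + v • hφ.continuous_x.frame hT t‖ ^ 2
      + (1 - v ^ 2) * ‖hφ.continuous_x.frame hT t‖ ^ 2) := by
  have hx := hφ.continuous_x.memL2_frame ht
  have hw : MemL2 0 L fun y => φt (y + v * t) t + v * φx (y + v * t) t :=
    MemLp.add (hφ.continuous_t.memL2_frame ht) (MemLp.const_mul hx v)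
  have ex := hφ.continuous_x.coeFn_frame hT ht
  have ew : ⇑(hφ.continuous_t.frame hT t + v • hφ.continuous_x.frame hT t)
      =ᵐ[volume.restrict (Ioo 0 L)] fun y => φt (y + v * t) t + v * φx (y + v * t) t :=
    (Lp.coeFn_add _ _).trans ((hφ.continuous_t.coeFn_frame hT ht).add
      ((Lp.coeFn_smul _ _).trans (ex.const_smul v)))
  rw [← real_inner_self_eq_norm_sq, ← real_inner_self_eq_norm_sq, inner_eq_integral hL ew ew,
    inner_eq_integral hL ex ex, energy, integral_moving, ← intervalIntegral.integral_const_mul (1 - v ^ 2),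
    ← intervalIntegral.integral_add (hw.intervalIntegrable_mul hL hw)
      ((hx.intervalIntegrable_mul hL hx).const_mul (1 - v ^ 2))]
  congr 2
  ext y
  simp only [energyDensity]
  ring

/-- The initial condition only prescribes `φ(·, 0)`; uniqueness of weak derivatives identifies
`φ_x(·, 0)` with `φ0x`. -/
theorem IsSolution.energy_zero (hφ : IsSolution L v T φ0 φ1 φ φx φt) (hL : 0 ≤ L)
    (hT : 0 ≤ T) {φ0x : ℝ → ℝ} (hφ0 : MemH10 0 L φ0 φ0x) :
    energy L v φx φt 0 = 1 / 2 * ∫ x in (0 : ℝ)..L,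
      ((φ1 x + v * φ0x x) ^ 2 + (1 - v ^ 2) * φ0x x ^ 2) := by
  have h0 : (0 : ℝ) ∈ Icc 0 T := ⟨le_rfl, hT⟩
  have h1 := hφ.mem_graphSpace hT h0
  have e1 : hφ.continuous.frame hT 0 = hφ0.memL2.toLp :=
    Lp.ext ((hφ.continuous.coeFn_frame hT h0).trans
      (EventuallyEq.trans (Eventually.mono hφ.init fun x hx => by simpa using hx)
        hφ0.memL2.coeFn_toLp.symm))
  rw [e1] at h1
  have e2 := graphSpace_snd_unique hL h1 hφ0.mem_graphSpace
  have e3 : (fun x => φx x 0) =ᵐ[volume.restrict (Ioo 0 L)] φ0x := by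
    have h := (hφ.continuous_x.coeFn_frame hT h0).symm
    rw [e2] at h
    simpa using h.trans (MemL2.coeFn_toLp _)
  rw [energy, mul_zero, add_zero, intervalIntegral.integral_of_le hL,
    intervalIntegral.integral_of_le hL, ← restrict_Ioo_eq_restrict_Ioc]
  congr 1
  refine integral_congr_ae ?_
  filter_upwards [e3, hφ.init_t] with x hx ht
  rw [energyDensity, hx, ht]

end Solution

/-! ### Fourier coefficients of the extended data. -/

section Fourier

variable {L v : ℝ}

theorem lt_L2 (hL : 0 < L) (hv0 : 0 < v) (hv1 : v < 1) : L < L2 L v := by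
  have h : 1 < 2 / (1 - v) := by rw [lt_div_iff₀] <;> linarith
  rw [L2]
  nlinarith

/-- The affine map `x ↦ -x/γ_v + 2L/(1 + v)` fixes `L` and sends `L₂` to `0`; the change of
variables produces the factor `γ_v`. -/
theorem integral_reflected_piece (hL : 0 < L) (hv0 : 0 < v) (hv1 : v < 1) {q g₁ g₂ : ℝ → ℝ}
    (h₁ : IntervalIntegrable g₁ volume 0 L) (h₂ : IntervalIntegrable g₂ volume 0 L)
    (hq₁ : ∀ x ∈ Ioo 0 L, q x = g₁ x)
    (hq₂ : ∀ x ∈ Ioo L (L2 L v), q x = g₂ (-x / gam v + 2 * L / (1 + v))) :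
    IntervalIntegrable q volume 0 (L2 L v) ∧
      ∫ x in (0 : ℝ)..(L2 L v), q x
        = (∫ x in (0 : ℝ)..L, g₁ x) + gam v * ∫ x in (0 : ℝ)..L, g₂ x := by
  have hlt := lt_L2 hL hv0 hv1
  have hv2 : 1 - v ≠ 0 := by linarith
  have hv3 : 1 + v ≠ 0 := by linarith
  have hg : gam v ≠ 0 := div_ne_zero hv3 hv2
  have hc : -(gam v)⁻¹ ≠ 0 := neg_ne_zero.mpr (inv_ne_zero hg)
  have e1 : -(gam v)⁻¹ * L + 2 * L / (1 + v) = L := by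
    rw [gam]; field_simp; ring
  have e2 : -(gam v)⁻¹ * L2 L v + 2 * L / (1 + v) = 0 := by
    rw [gam, L2]; field_simp; ring
  have hq₂' : ∀ x ∈ Ioo L (L2 L v), q x = g₂ (-(gam v)⁻¹ * x + 2 * L / (1 + v)) := by
    intro x hx
    rw [hq₂ x hx]
    congr 1
    ring
  have i1 : IntervalIntegrable q volume 0 L := by
    rw [intervalIntegrable_iff_integrableOn_Ioo_of_le hL.le] at h₁ ⊢
    exact h₁.congr_fun (fun x hx => (hq₁ x hx).symm) measurableSet_Ioo
  have i2 : IntervalIntegrable q volume L (L2 L v) := by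
    have h3 := (h₂.symm.comp_add_right (2 * L / (1 + v))).comp_mul_left (c := -(gam v)⁻¹)
    have h4 : (L - 2 * L / (1 + v)) / -(gam v)⁻¹ = L := by
      rw [div_eq_iff hc]; linarith
    have h5 : (0 - 2 * L / (1 + v)) / -(gam v)⁻¹ = L2 L v := by
      rw [div_eq_iff hc]; linarith
    rw [h4, h5, intervalIntegrable_iff_integrableOn_Ioo_of_le hlt.le] at h3
    rw [intervalIntegrable_iff_integrableOn_Ioo_of_le hlt.le]
    exact h3.congr_fun (fun x hx => (hq₂' x hx).symm) measurableSet_Ioo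
  refine ⟨i1.trans i2, ?_⟩
  rw [← intervalIntegral.integral_add_adjacent_intervals i1 i2,
    intervalIntegral.integral_congr_Ioo_of_le hL.le hq₁,
    intervalIntegral.integral_congr_Ioo_of_le hlt.le hq₂',
    intervalIntegral.integral_comp_mul_add _ hc, e1, e2, intervalIntegral.integral_symm 0 L,
    smul_eq_mul, inv_neg, inv_inv, neg_mul_neg]

theorem ext_add_of_mem {a b : ℝ → ℝ} {x : ℝ} (hx : x ∈ Ioo 0 L) :
    extX L v a x + extT L v b x = a x + b x := by
  simp [extX, extT, not_lt.mpr hx.1.le, hx.2]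

theorem ext_add_of_gt {a b : ℝ → ℝ} {x : ℝ} (hL : 0 < L) (hx : L < x) :
    extX L v a x + extT L v b x
      = (gam v)⁻¹ * (a (-x / gam v + 2 * L / (1 + v)) - b (-x / gam v + 2 * L / (1 + v))) := by
  simp only [extX, extT, not_lt.mpr (hL.trans hx).le, not_lt.mpr hx.le, if_false]
  ring

theorem MemL2.intervalIntegrable {a b : ℝ} (hab : a ≤ b) {f : ℝ → ℝ} (hf : MemL2 a b f) :
    IntervalIntegrable f volume a b := by
  rw [intervalIntegrable_iff_integrableOn_Ioo_of_le hab]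
  exact MemLp.integrable (by norm_num) hf

/-- Since `2/L₂ = (1 - v)/L`, the exponentials in `coeff` are exactly the characters of period `L₂`.
-/
theorem coeff_eq_fourierCoeffOn (hL : 0 < L) (hv1 : v < 1) (hℓ : 0 < L2 L v) (a b : ℝ → ℝ)
    {n : ℤ} (hn : n ≠ 0) :
    (n : ℂ) * coeff L v a b n = (L2 L v : ℂ) / (4 * Real.pi * Complex.I) *
      fourierCoeffOn hℓ (fun x => ((extX L v a x + extT L v b x : ℝ) : ℂ)) n := by
  have hv2 : (1 - v : ℂ) ≠ 0 := by
    have : 1 - v ≠ 0 := by linarith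
    exact_mod_cast this
  have hL' : (L : ℂ) ≠ 0 := by exact_mod_cast hL.ne'
  have hℓ' : (L2 L v : ℂ) ≠ 0 := by exact_mod_cast hℓ.ne'
  have hn' : (n : ℂ) ≠ 0 := by exact_mod_cast hn
  have hpi : (Real.pi : ℂ) ≠ 0 := by exact_mod_cast Real.pi_ne_zero
  rw [fourierCoeffOn_eq_integral, coeff]
  have h : ∀ x : ℝ, fourier (-n) (x : AddCircle (L2 L v - 0))
        • ((extX L v a x + extT L v b x : ℝ) : ℂ)
      = ((extX L v a x + extT L v b x : ℝ) : ℂ) *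
        Complex.exp (-(n * Real.pi * Complex.I * (1 - v) * x / L)) := by
    intro x
    rw [fourier_coe_apply, smul_eq_mul, mul_comm]
    congr 2
    rw [L2]
    push_cast
    field_simp
    ring
  simp_rw [h]
  rw [Complex.real_smul]
  push_cast
  rw [sub_zero]
  field_simp

/-- Parseval's identity for the coefficients `n c_n`. -/
theorem hasSum_sq_coeff (hL : 0 < L) (hv0 : 0 < v) (hv1 : v < 1) {a b : ℝ → ℝ}
    (ha : MemL2 0 L a) (hb : MemL2 0 L b) (ha0 : ∫ x in (0 : ℝ)..L, a x = 0) :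
    HasSum (fun n : {n : ℤ // n ≠ 0} => ‖(n : ℂ) * coeff L v a b n‖ ^ 2)
      (L2 L v / (16 * Real.pi ^ 2) * ((∫ x in (0 : ℝ)..L, (a x + b x) * (a x + b x))
        + (gam v)⁻¹ * ∫ x in (0 : ℝ)..L, (a x - b x) * (a x - b x))) := by
  have hℓ : 0 < L2 L v := hL.trans (lt_L2 hL hv0 hv1)
  have hg : gam v ≠ 0 := div_ne_zero (by linarith) (by linarith)
  have hp : MemL2 0 L fun x => a x + b x := MemLp.add ha hb
  have hm : MemL2 0 L fun x => a x - b x := MemLp.sub ha hb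
  set q : ℝ → ℝ := fun x => extX L v a x + extT L v b x with hq
  obtain ⟨i1, I1⟩ := integral_reflected_piece hL hv0 hv1 (q := q)
    (hp.intervalIntegrable hL.le) ((hm.intervalIntegrable hL.le).const_mul (gam v)⁻¹)
    (fun x hx => ext_add_of_mem hx) (fun x hx => ext_add_of_gt hL hx.1)
  obtain ⟨i2, I2⟩ := integral_reflected_piece hL hv0 hv1 (q := fun x => q x ^ 2)
    (hp.intervalIntegrable_mul hL.le hp)
    ((hm.intervalIntegrable_mul hL.le hm).const_mul ((gam v)⁻¹ ^ 2))
    (fun x hx => by simp only [hq]; rw [ext_add_of_mem hx, sq])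
    (fun x hx => by simp only [hq]; rw [ext_add_of_gt hL hx.1]; ring)
  rw [intervalIntegral.integral_const_mul, mul_inv_cancel_left₀ hg,
    ← intervalIntegral.integral_add (hp.intervalIntegrable hL.le) (hm.intervalIntegrable hL.le)]
    at I1
  -- The Jacobian `γ_v` cancels the factor `1/γ_v` of the extension, so the `b` contributions of the
  -- two pieces cancel and `2 ∫ a = 0` remains.
  have hzero : ∫ x in (0 : ℝ)..(L2 L v), q x = 0 := by
    rw [I1]
    have : ∀ x, a x + b x + (a x - b x) = 2 * a x := fun x => by ring
    simp_rw [this]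
    rw [intervalIntegral.integral_const_mul, ha0, mul_zero]
  -- For the square, the Jacobian cancels only one of the two factors `1/γ_v`.
  rw [intervalIntegral.integral_const_mul, sq (gam v)⁻¹, mul_assoc (gam v)⁻¹,
    mul_inv_cancel_left₀ hg] at I2
  rw [intervalIntegrable_iff_integrableOn_Ioc_of_le hℓ.le] at i1 i2
  have hmem : MemLp (fun x => (q x : ℂ)) 2 (volume.restrict (Ioc 0 (L2 L v))) :=
    MemLp.ofReal ((memLp_two_iff_integrable_sq i1.aestronglyMeasurable).mpr i2)
  have hs := hasSum_sq_fourierCoeffOn hℓ hmem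
  have h0 : fourierCoeffOn hℓ (fun x => (q x : ℂ)) 0 = 0 := by
    rw [fourierCoeffOn_eq_integral]
    simp only [neg_zero, fourier_zero, one_smul]
    rw [intervalIntegral.integral_ofReal, hzero]
    simp
  have hs' : HasSum (fun n : {n : ℤ // n ≠ 0} =>
      ‖fourierCoeffOn hℓ (fun x => (q x : ℂ)) n‖ ^ 2) _ :=
    (hasSum_subtype_iff_of_support_subset (s := {n : ℤ | n ≠ 0}) fun n hn h => hn (by
      rw [h, h0]; simp)).mpr hs
  have key := hs'.mul_left ((L2 L v) ^ 2 / (16 * Real.pi ^ 2))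
  have hval : L2 L v ^ 2 / (16 * Real.pi ^ 2) * ((L2 L v - 0)⁻¹ •
        ∫ x in (0 : ℝ)..(L2 L v), ‖(q x : ℂ)‖ ^ 2)
      = L2 L v / (16 * Real.pi ^ 2) * ((∫ x in (0 : ℝ)..L, (a x + b x) * (a x + b x))
        + (gam v)⁻¹ * ∫ x in (0 : ℝ)..L, (a x - b x) * (a x - b x)) := by
    simp only [Complex.norm_real, Real.norm_eq_abs, sq_abs]
    rw [I2, sub_zero, smul_eq_mul]
    field_simp
  rw [hval] at key
  refine (congrArg (HasSum · _) (funext fun n => ?_)).mpr key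
  rw [coeff_eq_fourierCoeffOn hL hv1 hℓ a b n.2, norm_mul, mul_pow]
  congr 1
  rw [norm_div, norm_mul, norm_mul, Complex.norm_I, Complex.norm_real, Complex.norm_real,
    Real.norm_of_nonneg hℓ.le, Real.norm_of_nonneg Real.pi_pos.le]
  norm_num
  ring

end Fourier

end MovingString

theorem theorem3p1 (L v T : ℝ) (hL : 0 < L) (hv0 : 0 < v) (hv1 : v < 1) (hT : 0 < T)
    (φ0 φ0x φ1 : ℝ → ℝ)
    (hφ0 : MovingString.MemH10 0 L φ0 φ0x) (hφ1 : MovingString.MemL2 0 L φ1)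
    (φ φx φt : ℝ → ℝ → ℝ)
    (hφ : MovingString.IsSolution L v T φ0 φ1 φ φx φt) :
    Summable (fun n : {n : ℤ // n ≠ 0} =>
      ‖(n : ℂ) * MovingString.coeff L v φ0x φ1 n‖ ^ 2) ∧
    ∀ t ∈ Icc 0 T,
      IntervalIntegrable (MovingString.energyDensity v φx φt t) volume (v * t) (L + v * t) ∧
      MovingString.energy L v φx φt t = MovingString.energy L v φx φt 0 ∧
      MovingString.energy L v φx φt t =
        2 * Real.pi ^ 2 * (1 - v ^ 2) / L *
          ∑' n : {n : ℤ // n ≠ 0}, ‖(n : ℂ) * MovingString.coeff L v φ0x φ1 n‖ ^ 2 := by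
  have hsum := MovingString.hasSum_sq_coeff hL hv0 hv1 hφ0.memL2_deriv hφ1
    (hφ0.integral_deriv_eq_zero hL.le)
  have hcons : ∀ t ∈ Icc 0 T, MovingString.energy L v φx φt t
      = MovingString.energy L v φx φt 0 := fun t ht => by
    rw [hφ.energy_eq_norm_sq hL.le hT.le ht, hφ.energy_eq_norm_sq hL.le hT.le ⟨le_rfl, hT.le⟩,
      hφ.norm_sq_conserved hL.le hT t ht]
  refine ⟨hsum.summable, fun t ht => ⟨hφ.intervalIntegrable_energyDensity hL.le ht, hcons t ht, ?_⟩⟩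
  have hp : MovingString.MemL2 0 L fun x => φ0x x + φ1 x := MemLp.add hφ0.memL2_deriv hφ1
  have hm : MovingString.MemL2 0 L fun x => φ0x x - φ1 x := MemLp.sub hφ0.memL2_deriv hφ1
  have hv2 : 1 - v ≠ 0 := by linarith
  have hv3 : 1 + v ≠ 0 := by linarith
  -- The weights `(1 + v)/2` and `(1 - v)/2` have ratio `1/γ_v`, matching the two terms in `hsum`.
  have hsplit : ∫ x in (0 : ℝ)..L, ((φ1 x + v * φ0x x) ^ 2 + (1 - v ^ 2) * φ0x x ^ 2)
      = (1 + v) / 2 * (∫ x in (0 : ℝ)..L, (φ0x x + φ1 x) * (φ0x x + φ1 x))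
        + (1 - v) / 2 * ∫ x in (0 : ℝ)..L, (φ0x x - φ1 x) * (φ0x x - φ1 x) := by
    rw [← intervalIntegral.integral_const_mul, ← intervalIntegral.integral_const_mul,
      ← intervalIntegral.integral_add ((hp.intervalIntegrable_mul hL.le hp).const_mul _)
        ((hm.intervalIntegrable_mul hL.le hm).const_mul _)]
    congr 1
    ext x
    ring
  rw [hcons t ht, hφ.energy_zero hL.le hT.le hφ0, hsum.tsum_eq, hsplit, MovingString.L2,
    MovingString.gam]
  field_simp
  ring
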